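/- There is a universal constant $C>0$ such that the following holds. Let $G=(V,E,w)$ be a finite connected weighted undirected graph (without loops; parallel edges are allowed) with edge weights $w_e>0$, let $s\neq t$ be vertices of $G$, let $d$ be the maximum, over the vertices, of the number of incident edges, let $c=\max_{e\in E}w_e/\min_{e\in E}w_e$, and let $\phi=\min_{\emptyset\neq S\subsetneq V}\frac{w(S,V\setminus S)}{\min(w(S),w(V\setminus S))}$ be the expansion of $G$, where $w(S,V\setminus S)$ is the total weight of the edges between $S$ and $V\setminus S$ and $w(S)=\sum_{v\in S}\sum_{e\ni v}w_e$. Suppose that the weights are scaled so that $\frac1{dc}\le w_e\le\frac1d$ for all $e\in E$. Let $G'=(V,E',w)$, $E'=E\cup\{0\}$, be obtained from $G$ by adding one further edge $0$ of weight $w_0=1$ between $s$ and $t$. Orient the edges of $G$ arbitrarily and the edge $0$ from $t$ to $s$, and write $e^+$ and $e^-$ for the head and the tail of $e$. Let $E'(v)$ be the set of edges of $G'$ incident to $v$, let $d'_v=\sum_{e\in E'(v)}w_e$, and put $$|a_v\rangle=\frac1{\sqrt{d'_v}}\sum_{e\in E'(v)}\sqrt{w_e}\,|e\rangle,\qquad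 |b_e\rangle=\frac1{\sqrt2}\bigl(|e^+\rangle-|e^-\rangle\bigr),$$ $$A=\sum_{v\in V}|a_v\rangle|v\rangle\langle v|,\qquad B=\sum_{e\in E'}|e\rangle|b_e\rangle\langle e|.$$ Let $U(A,B)=\mathrm{refl}(B)\cdot\mathrm{refl}(A)$, where $\mathrm{refl}(X)=2\Pi_X-I$ and $\Pi_X$ is the orthogonal projection onto the column space of $X$. Then the eigenvalue gap $\Delta=\min\{|\mu+1| : \mu\neq-1 \text{ an eigenvalue of } U(A,B)\}$ of $U(A,B)$ around $-1$ satisfies $$\Delta\ \ge\ C\,\frac{\phi}{\sqrt{dc}}.$$ -/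

import Mathlib

/-- A weighted undirected multigraph without loops, with vertex set `V` and edge set `E`, together
with an arbitrary orientation of its edges: `head e` is `e⁺` and `tail e` is `e⁻`.
Parallel edges are allowed; every simple weighted graph is of this form. -/
structure WeightedGraph (V : Type*) (E : Type*) where
  head : E → V
  tail : E → V
  head_ne_tail : ∀ e, head e ≠ tail e
  w : E → ℝ
  w_pos : ∀ e, 0 < w e

namespace WeightedGraph

section Basic

variable {V E : Type*} (G : WeightedGraph V E)

/-- The underlying simple graph: two vertices are adjacent iff some edge joins them. -/
def toSimpleGraph : SimpleGraph V where
  Adj u v := ∃ e, (G.head e = u ∧ G.tail e = v) ∨ (G.head e = v ∧ G.tail e = u)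
  symm := ⟨fun _ _ ⟨e, he⟩ => ⟨e, he.symm⟩⟩
  loopless := ⟨by
    rintro v ⟨e, ⟨h1, h2⟩ | ⟨h1, h2⟩⟩ <;> exact G.head_ne_tail e (h1.trans h2.symm)⟩

/-- The graph is connected (ignoring orientations). -/
def Connected : Prop := G.toSimpleGraph.Connected

/-- The ratio of the largest to the smallest edge weight. -/
noncomputable def weightRatio : ℝ := (⨆ e, G.w e) / (⨅ e, G.w e)

/-- The graph `G'`: one more edge, labelled `none`, of weight `1`, oriented from `t` to `s`. -/
def addUnitEdge (s t : V) (hst : s ≠ t) : WeightedGraph V (Option E) where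
  head e := e.elim s G.head
  tail e := e.elim t G.tail
  head_ne_tail e := by
    cases e with
    | none => exact hst
    | some e => exact G.head_ne_tail e
  w e := e.elim 1 G.w
  w_pos e := by
    cases e with
    | none => exact one_pos
    | some e => exact G.w_pos e

variable [Fintype E] [DecidableEq V]

/-- The set `E(v)` of edges incident to `v`. -/
def incidentEdges (v : V) : Finset E :=
  Finset.univ.filter fun e => G.head e = v ∨ G.tail e = v

/-- The weighted degree of `v`. -/
def wdeg (v : V) : ℝ := ∑ e ∈ G.incidentEdges v, G.w e

/-- The maximum over the vertices `v` of the number of edges incident to `v`. -/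
def maxDegree [Fintype V] : ℕ := Finset.univ.sup fun v => (G.incidentEdges v).card

/-- The weight `w(S) = ∑_{v ∈ S} wdeg v` of a set of vertices. -/
noncomputable def vol (S : Finset V) : ℝ := ∑ v ∈ S, G.wdeg v

/-- The sum of `w_{u,v}` over all `u ∈ S`, `v ∈ T` joined by an edge. -/
noncomputable def cutWeight (S T : Finset V) : ℝ :=
  ∑ e, ((if G.head e ∈ S ∧ G.tail e ∈ T then G.w e else 0) +
    (if G.tail e ∈ S ∧ G.head e ∈ T then G.w e else 0))

/-- The expansion of a set `S` of vertices. -/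
noncomputable def expansionOf [Fintype V] (S : Finset V) : ℝ :=
  G.cutWeight S Sᶜ / min (G.vol S) (G.vol Sᶜ)

/-- The expansion of the graph: the minimum of the expansion of `S` over all `S` such that
`S` and its complement are nonempty. -/
noncomputable def expansion [Fintype V] : ℝ :=
  ⨅ S : {S : Finset V // S.Nonempty ∧ Sᶜ.Nonempty}, G.expansionOf S.1

/-- The coordinate at the edge `e` of `|a_v⟩ = (wdeg v)^{-1/2} ∑_{e ∈ E(v)} √w_e |e⟩`. -/
noncomputable def aVec (v : V) (e : E) : ℂ :=
  if G.head e = v ∨ G.tail e = v then ((√(G.w e) / √(G.wdeg v) : ℝ) : ℂ) else 0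

/-- The coordinate at the vertex `v` of `|b_e⟩ = (|e⁺⟩ - |e⁻⟩) / √2`. -/
noncomputable def bVec (e : E) (v : V) : ℂ :=
  (((if v = G.head e then 1 else 0) - (if v = G.tail e then 1 else 0)) / √2 : ℝ)

/-- The matrix `A = ∑_v |a_v⟩|v⟩⟨v|`. -/
noncomputable def walkA : Matrix (E × V) V ℂ :=
  fun p v => if p.2 = v then G.aVec v p.1 else 0

/-- The matrix `B = ∑_e |e⟩|b_e⟩⟨e|`. -/
noncomputable def walkB [DecidableEq E] : Matrix (E × V) E ℂ :=
  fun p e => if p.1 = e then G.bVec e p.2 else 0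

end Basic

end WeightedGraph

/-- The column space of a complex matrix. -/
noncomputable def Matrix.columnSpace {ι κ : Type*} [Fintype ι] [Fintype κ] [DecidableEq κ]
    (A : Matrix ι κ ℂ) : Submodule ℂ (EuclideanSpace ℂ ι) :=
  LinearMap.range (Matrix.toEuclideanLin A)

/-- The operator `refl(A) = 2 Π_A - I`, with `Π_A` the orthogonal projection onto the column
space of `A`. -/
noncomputable def Matrix.columnReflection {ι κ : Type*} [Fintype ι] [Fintype κ] [DecidableEq κ]
    (A : Matrix ι κ ℂ) : Module.End ℂ (EuclideanSpace ℂ ι) :=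
  (A.columnSpace.reflection).toLinearEquiv.toLinearMap

/-- The walk operator `U(A, B) = refl(B) · refl(A)`. -/
noncomputable def walkOperator {ι κ₁ κ₂ : Type*} [Fintype ι] [Fintype κ₁] [DecidableEq κ₁]
    [Fintype κ₂] [DecidableEq κ₂] (A : Matrix ι κ₁ ℂ) (B : Matrix ι κ₂ ℂ) :
    Module.End ℂ (EuclideanSpace ℂ ι) :=
  B.columnReflection * A.columnReflection

/-- The eigenvalue gap of `T` around `z`: the least distance to `z` of an eigenvalue of `T`
different from `z`. -/
noncomputable def eigenvalueGap {H : Type*} [AddCommGroup H] [Module ℂ H]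
    (T : Module.End ℂ H) (z : ℂ) : ℝ :=
  sInf ((fun μ : ℂ => ‖μ - z‖) '' {μ : ℂ | T.HasEigenvalue μ ∧ μ ≠ z})

/-! For an eigenvalue `μ ≠ ±1` of a product of two reflections, projecting the eigenvector to the
column space of `A` gives a vector `a` with `‖Π_B a‖² = ‖1 + μ‖² / 4 * ‖a‖²`. Such an `a` is
`edgeLift f` for a function `f` on the vertices: `‖a‖²` is the degree-weighted norm of `f`, and
`‖Π_B a‖²` is half its Dirichlet energy. So `‖1 + μ‖² / 2` is a Rayleigh quotient of the normalized
Laplacian of `G'`, taken at a function of weighted mean zero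
(`exists_of_hasEigenvalue_walkOperator`).

Cheeger's inequality (`exists_cheeger`) bounds such quotients below by `φ² / 2` on `G`. Passing to
`G'` only increases the energy and, since every degree of `G` is at least `1/(dc)`, multiplies
degrees by at most `1 + dc`. Hence `φ² ≤ (1 + dc) ‖1 + μ‖²`. The eigenvalue `μ = 1` is at distance
`2` from `-1` and is harmless because `φ ≤ 1`. -/

namespace WeightedGraph

/-! ### Cheeger's inequality for weighted multigraphs. -/

section Cheeger

variable {V E : Type*} [Fintype E] [DecidableEq V] (G : WeightedGraph V E)

theorem wdeg_eq_sum (v : V) :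
    G.wdeg v = ∑ e, G.w e * ((if G.head e = v then 1 else 0) + (if G.tail e = v then 1 else 0)) := by
  rw [wdeg, incidentEdges, Finset.sum_filter]
  refine Finset.sum_congr rfl fun e _ => ?_
  have := G.head_ne_tail e
  by_cases h1 : G.head e = v
  · have h2 : G.tail e ≠ v := fun h => this (h1.trans h.symm)
    simp [h1, h2]
  · simp [h1]

theorem wdeg_nonneg (v : V) : 0 ≤ G.wdeg v :=
  Finset.sum_nonneg fun e _ => (G.w_pos e).le

theorem vol_nonneg (S : Finset V) : 0 ≤ G.vol S :=
  Finset.sum_nonneg fun v _ => G.wdeg_nonneg v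

theorem vol_mono {S T : Finset V} (h : S ⊆ T) : G.vol S ≤ G.vol T :=
  Finset.sum_le_sum_of_subset_of_nonneg h fun v _ _ => G.wdeg_nonneg v

theorem cutWeight_nonneg (S T : Finset V) : 0 ≤ G.cutWeight S T :=
  Finset.sum_nonneg fun e _ => by
    have := (G.w_pos e).le
    positivity

variable [Fintype V]

/-- Double counting of incidences; module values cover both real and complex functions. -/
theorem sum_wdeg_smul {M : Type*} [AddCommGroup M] [Module ℝ M] (F : V → M) :
    ∑ v, G.wdeg v • F v = ∑ e, G.w e • (F (G.head e) + F (G.tail e)) := by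
  simp_rw [wdeg_eq_sum, Finset.sum_smul]
  rw [Finset.sum_comm]
  refine Finset.sum_congr rfl fun e _ => ?_
  simp [mul_smul, add_smul, Finset.sum_add_distrib]

theorem sum_wdeg_mul (F : V → ℝ) :
    ∑ v, G.wdeg v * F v = ∑ e, G.w e * (F (G.head e) + F (G.tail e)) :=
  G.sum_wdeg_smul F

theorem vol_eq_sum_mul (S : Finset V) : G.vol S = ∑ v, G.wdeg v * (if v ∈ S then 1 else 0) := by
  simp [vol]

theorem vol_eq_sum (S : Finset V) :
    G.vol S = ∑ e, G.w e * ((if G.head e ∈ S then 1 else 0) + (if G.tail e ∈ S then 1 else 0)) := by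
  rw [vol_eq_sum_mul, sum_wdeg_mul]

theorem cutWeight_compl_eq (S : Finset V) :
    G.cutWeight S Sᶜ =
      ∑ e, G.w e * |(if G.head e ∈ S then 1 else 0) - (if G.tail e ∈ S then 1 else 0)| := by
  refine Finset.sum_congr rfl fun e _ => ?_
  by_cases h1 : G.head e ∈ S <;> by_cases h2 : G.tail e ∈ S <;> simp [h1, h2]

theorem cutWeight_compl_comm (S : Finset V) : G.cutWeight S Sᶜ = G.cutWeight Sᶜ Sᶜᶜ := by
  refine Finset.sum_congr rfl fun e _ => ?_
  by_cases h1 : G.head e ∈ S <;> by_cases h2 : G.tail e ∈ S <;> simp [h1, h2]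

theorem cutWeight_compl_le_vol (S : Finset V) : G.cutWeight S Sᶜ ≤ G.vol S := by
  rw [cutWeight_compl_eq, vol_eq_sum]
  refine Finset.sum_le_sum fun e _ => mul_le_mul_of_nonneg_left ?_ (G.w_pos e).le
  split_ifs <;> norm_num

theorem expansionOf_nonneg (S : Finset V) : 0 ≤ G.expansionOf S :=
  div_nonneg (G.cutWeight_nonneg _ _) (le_min (G.vol_nonneg _) (G.vol_nonneg _))

theorem expansionOf_le_one (S : Finset V) : G.expansionOf S ≤ 1 := by
  refine div_le_one_of_le₀ (le_min (G.cutWeight_compl_le_vol S) ?_)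
    (le_min (G.vol_nonneg _) (G.vol_nonneg _))
  rw [cutWeight_compl_comm]
  exact G.cutWeight_compl_le_vol _

theorem expansion_nonneg : 0 ≤ G.expansion := Real.iInf_nonneg fun S => G.expansionOf_nonneg S.1

theorem expansion_le {S : Finset V} (h : S.Nonempty) (h' : Sᶜ.Nonempty) :
    G.expansion ≤ G.expansionOf S :=
  ciInf_le (Set.finite_range _).bddBelow (⟨S, h, h'⟩ : {S : Finset V // S.Nonempty ∧ Sᶜ.Nonempty})

theorem expansion_le_one [Nontrivial V] : G.expansion ≤ 1 := by
  obtain ⟨s, t, hst⟩ := exists_pair_ne V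
  exact (G.expansion_le (S := {s}) ⟨s, by simp⟩ ⟨t, by simpa using hst.symm⟩).trans
    (G.expansionOf_le_one _)

/-- A set with at most half of the volume has a cut of weight at least the expansion times its
volume. -/
theorem expansion_mul_vol_le {S : Finset V} (h : 2 * G.vol S ≤ G.vol Finset.univ) :
    G.expansion * G.vol S ≤ G.cutWeight S Sᶜ := by
  rcases (G.vol_nonneg S).eq_or_lt with h0 | h0
  · rw [← h0, mul_zero]
    exact G.cutWeight_nonneg _ _
  have hsum : G.vol S + G.vol Sᶜ = G.vol Finset.univ := Finset.sum_add_sum_compl S _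
  have hS : S.Nonempty := by
    rw [Finset.nonempty_iff_ne_empty]
    rintro rfl
    simp [vol] at h0
  have hS' : Sᶜ.Nonempty := by
    rw [Finset.nonempty_iff_ne_empty]
    intro h'
    rw [h'] at hsum
    have : G.vol (∅ : Finset V) = 0 := by simp [vol]
    linarith
  have h1 := G.expansion_le hS hS'
  rw [expansionOf, min_eq_left (by linarith)] at h1
  exact (le_div_iff₀ h0).1 h1

/-- The discrete co-area inequality: an `L¹` isoperimetric inequality for functions supported on
at most half of the volume. -/
theorem expansion_mul_sum_le (F : V → ℝ) (hF : ∀ v, 0 ≤ F v)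
    (h : 2 * G.vol (Finset.univ.filter fun v => 0 < F v) ≤ G.vol Finset.univ) :
    G.expansion * ∑ v, G.wdeg v * F v ≤ ∑ e, G.w e * |F (G.head e) - F (G.tail e)| := by
  induction hn : (Finset.univ.filter fun v => 0 < F v).card using Nat.strong_induction_on
    generalizing F with
  | _ n ih =>
  set S := Finset.univ.filter fun v => 0 < F v with hS
  have hzero : ∀ v, v ∉ S → F v = 0 := fun v hv =>
    le_antisymm (not_lt.1 fun h' => hv (by simpa [hS] using h')) (hF v)
  rcases S.eq_empty_or_nonempty with he | hne
  · have : ∀ v, F v = 0 := fun v => hzero v (by simp [he])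
    simp [this]
  obtain ⟨u, hu, hmin⟩ := S.exists_min_image F hne
  have hupos : 0 < F u := by simpa [hS] using hu
  -- Peel off the lowest layer of the layer-cake decomposition: subtracting the least positive value
  -- on the support removes `u` from it, so the induction applies to `F'`.
  let F' : V → ℝ := fun v => F v - F u * (if v ∈ S then 1 else 0)
  have hF'eq : ∀ v, F v = F' v + F u * (if v ∈ S then 1 else 0) := fun v => by simp [F']
  have hF' : ∀ v, 0 ≤ F' v := fun v => by
    by_cases hv : v ∈ S
    · simpa [F', hv] using hmin v hv
    · simpa [F', hv] using hF v
  have hsub : (Finset.univ.filter fun v => 0 < F' v) ⊂ S := by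
    rw [Finset.ssubset_iff_of_subset]
    · exact ⟨u, hu, by simp [F', hu]⟩
    · intro v hv
      by_contra hv'
      simp [F', hv', hzero v hv'] at hv
  have key := ih _ (hn ▸ Finset.card_lt_card hsub) F' hF'
    ((mul_le_mul_of_nonneg_left (G.vol_mono hsub.subset) zero_le_two).trans h) rfl
  have h1 : ∑ v, G.wdeg v * F v = ∑ v, G.wdeg v * F' v + F u * G.vol S := by
    rw [vol_eq_sum_mul, Finset.mul_sum, ← Finset.sum_add_distrib]
    refine Finset.sum_congr rfl fun v _ => ?_
    rw [hF'eq v]; ring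
  have h2 : ∑ e, G.w e * |F (G.head e) - F (G.tail e)|
      = ∑ e, G.w e * |F' (G.head e) - F' (G.tail e)| + F u * G.cutWeight S Sᶜ := by
    rw [cutWeight_compl_eq, Finset.mul_sum, ← Finset.sum_add_distrib]
    refine Finset.sum_congr rfl fun e _ => ?_
    rw [mul_left_comm, ← mul_add]
    congr 1
    -- Only edges across the cut feel the removed layer, each by exactly `F u`.
    have aux : ∀ a b, a ∈ S → b ∉ S → |F a - F b| = |F' a - F' b| + F u := fun a b ha hb => by
      have ha' : F' a = F a - F u := by simp [F', ha]
      have hb' : F' b = 0 := by simp [F', hb, hzero b hb]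
      have h3 := hF' a
      rw [hzero b hb, hb', sub_zero, sub_zero, abs_of_nonneg (hF a), abs_of_nonneg h3, ha']
      ring
    by_cases ha : G.head e ∈ S <;> by_cases hb : G.tail e ∈ S
    · simp [F', ha, hb]
    · simp [ha, hb, aux _ _ ha hb]
    · rw [abs_sub_comm, aux _ _ hb ha, abs_sub_comm]
      simp [ha, hb]
    · simp [F', ha, hb]
  rw [h1, h2]
  nlinarith [mul_le_mul_of_nonneg_left (G.expansion_mul_vol_le h) hupos.le]

/-- The co-area inequality for `F ^ 2`, followed by Cauchy–Schwarz on `x² - y² = (x - y)(x + y)`. -/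
theorem expansion_sq_mul_sum_le (F : V → ℝ) (hF : ∀ v, 0 ≤ F v)
    (h : 2 * G.vol (Finset.univ.filter fun v => 0 < F v) ≤ G.vol Finset.univ) :
    G.expansion ^ 2 * ∑ v, G.wdeg v * F v ^ 2
      ≤ 2 * ∑ e, G.w e * (F (G.head e) - F (G.tail e)) ^ 2 := by
  set X := ∑ v, G.wdeg v * F v ^ 2
  set Y := ∑ e, G.w e * (F (G.head e) - F (G.tail e)) ^ 2
  set Z := ∑ e, G.w e * |F (G.head e) ^ 2 - F (G.tail e) ^ 2|
  have hX : 0 ≤ X := Finset.sum_nonneg fun v _ => mul_nonneg (G.wdeg_nonneg v) (sq_nonneg _)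
  have hY : 0 ≤ Y := Finset.sum_nonneg fun e _ => mul_nonneg (G.w_pos e).le (sq_nonneg _)
  have h1 : G.expansion * X ≤ Z := by
    refine G.expansion_mul_sum_le (fun v => F v ^ 2) (fun v => sq_nonneg _) ?_
    have hiff : ∀ v, 0 < F v ^ 2 ↔ 0 < F v := fun v =>
      ⟨fun h' => (hF v).lt_of_ne' fun h0 => by simp [h0] at h', fun h' => by positivity⟩
    simpa only [hiff] using h
  have h2 : Z ^ 2 ≤ Y * ∑ e, G.w e * (F (G.head e) + F (G.tail e)) ^ 2 := by
    refine Finset.sum_sq_le_sum_mul_sum_of_sq_le_mul _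
      (fun e _ => mul_nonneg (G.w_pos e).le (sq_nonneg _))
      (fun e _ => mul_nonneg (G.w_pos e).le (sq_nonneg _)) fun e _ => ?_
    rw [mul_pow, sq_abs]; exact le_of_eq (by ring)
  have h3 : ∑ e, G.w e * (F (G.head e) + F (G.tail e)) ^ 2 ≤ 2 * X := by
    simp only [X]
    rw [sum_wdeg_mul, Finset.mul_sum]
    refine Finset.sum_le_sum fun e _ => ?_
    rw [mul_left_comm]
    refine mul_le_mul_of_nonneg_left ?_ (G.w_pos e).le
    nlinarith [sq_nonneg (F (G.head e) - F (G.tail e))]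
  have h4 : (G.expansion * X) ^ 2 ≤ 2 * Y * X := by
    have := pow_le_pow_left₀ (mul_nonneg G.expansion_nonneg hX) h1 2
    nlinarith [mul_le_mul_of_nonneg_left h3 hY]
  rcases hX.eq_or_lt with h0 | h0
  · rw [← h0, mul_zero]; positivity
  · refine le_of_mul_le_mul_right ?_ h0
    linarith [h4, mul_pow G.expansion X 2, sq X]

/-- Every function on the vertices has a median with respect to the volume. -/
theorem exists_median [Nonempty V] (g : V → ℝ) :
    ∃ m, 2 * G.vol (Finset.univ.filter fun v => m < g v) ≤ G.vol Finset.univ ∧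
      2 * G.vol (Finset.univ.filter fun v => g v < m) ≤ G.vol Finset.univ := by
  set T := Finset.univ.filter fun u =>
    2 * G.vol (Finset.univ.filter fun v => g u < g v) ≤ G.vol Finset.univ with hT
  have hne : T.Nonempty := by
    obtain ⟨u, -, hu⟩ := Finset.univ.exists_max_image g Finset.univ_nonempty
    refine ⟨u, ?_⟩
    have : (Finset.univ.filter fun v => g u < g v) = ∅ := by
      ext v; simpa using hu v (Finset.mem_univ v)
    simp only [hT, Finset.mem_filter, Finset.mem_univ, true_and, this]
    simpa [vol] using G.vol_nonneg Finset.univ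
  obtain ⟨u, hu, hmin⟩ := T.exists_min_image g hne
  refine ⟨g u, by simpa [hT] using hu, ?_⟩
  rcases (Finset.univ.filter fun v => g v < g u).eq_empty_or_nonempty with he | hne'
  · rw [he]
    simpa [vol] using G.vol_nonneg Finset.univ
  -- `g u` is the least value in `T`, and `g z` is the next value below it. As `z ∉ T`, more than
  -- half of the volume lies above `g z`, leaving less than half for `g < g u`.
  obtain ⟨z, hz, hmax⟩ := Finset.exists_max_image _ g hne'
  have hzT : z ∉ T := fun h => (hmin z h).not_gt (by simpa using hz)
  simp only [hT, Finset.mem_filter, Finset.mem_univ, true_and, not_le] at hzT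
  have hle : G.vol (Finset.univ.filter fun v => g v < g u)
      ≤ G.vol (Finset.univ.filter fun v => g z < g v)ᶜ :=
    G.vol_mono fun v hv => by simpa using hmax v hv
  have hsum : G.vol (Finset.univ.filter fun v => g z < g v)
      + G.vol (Finset.univ.filter fun v => g z < g v)ᶜ = G.vol Finset.univ :=
    Finset.sum_add_sum_compl _ _
  linarith

/-- Cheeger's inequality, in the form of a Poincaré inequality. -/
theorem exists_cheeger [Nonempty V] (g : V → ℝ) :
    ∃ m, G.expansion ^ 2 * ∑ v, G.wdeg v * (g v - m) ^ 2
      ≤ 2 * ∑ e, G.w e * (g (G.head e) - g (G.tail e)) ^ 2 := by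
  obtain ⟨m, h1, h2⟩ := G.exists_median g
  refine ⟨m, ?_⟩
  have hp := G.expansion_sq_mul_sum_le (fun v => max (g v - m) 0) (fun v => le_max_right _ _)
    (by simpa using h1)
  have hq := G.expansion_sq_mul_sum_le (fun v => max (m - g v) 0) (fun v => le_max_right _ _)
    (by simpa using h2)
  have hsq : ∀ x y : ℝ, (x - y) ^ 2 = max (x - y) 0 ^ 2 + max (y - x) 0 ^ 2 := fun x y => by
    rcases le_total x y with h | h
    · rw [max_eq_right (by linarith), max_eq_left (by linarith)]; ring
    · rw [max_eq_left (by linarith), max_eq_right (by linarith)]; ring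
  have hsum : ∑ v, G.wdeg v * (g v - m) ^ 2
      = ∑ v, G.wdeg v * max (g v - m) 0 ^ 2 + ∑ v, G.wdeg v * max (m - g v) 0 ^ 2 := by
    rw [← Finset.sum_add_distrib]
    exact Finset.sum_congr rfl fun v _ => by rw [hsq]; ring
  -- Splitting `g - m` into positive and negative parts does not increase the energy: an edge
  -- crossing `m` only loses a cross term.
  have hen : ∑ e, G.w e * (max (g (G.head e) - m) 0 - max (g (G.tail e) - m) 0) ^ 2
      + ∑ e, G.w e * (max (m - g (G.head e)) 0 - max (m - g (G.tail e)) 0) ^ 2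
      ≤ ∑ e, G.w e * (g (G.head e) - g (G.tail e)) ^ 2 := by
    rw [← Finset.sum_add_distrib]
    refine Finset.sum_le_sum fun e _ => ?_
    rw [← mul_add]
    refine mul_le_mul_of_nonneg_left ?_ (G.w_pos e).le
    generalize g (G.head e) = x, g (G.tail e) = y
    rcases le_total x m with hx | hx <;> rcases le_total y m with hy | hy <;>
      simp only [max_eq_left, max_eq_right, sub_nonneg, sub_nonpos, hx, hy] <;>
      nlinarith [mul_nonneg (sub_nonneg.2 hx) (sub_nonneg.2 hy)]
  rw [hsum, mul_add]
  linarith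

end Cheeger

end WeightedGraph

/-! ### Eigenvalues of unitaries and of products of two reflections. -/

section Reflections

open scoped InnerProductSpace

variable {H : Type*} [NormedAddCommGroup H] [InnerProductSpace ℂ H]

/-- A unitary operator other than `-1` has an eigenvalue other than `-1`. -/
theorem LinearIsometryEquiv.exists_hasEigenvalue_ne_neg_one [FiniteDimensional ℂ H]
    (U : H ≃ₗᵢ[ℂ] H) {x : H} (hx : U x ≠ -x) :
    ∃ μ : ℂ, Module.End.HasEigenvalue (U.toLinearEquiv.toLinearMap : Module.End ℂ H) μ ∧
      μ ≠ -1 := by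
  set T : Module.End ℂ H := U.toLinearEquiv.toLinearMap
  have hT : ∀ y, T y = U y := fun _ => rfl
  set K := T.eigenspace (-1)
  have hK : ∀ y, y ∈ K ↔ U y = -y := fun y => by
    rw [Module.End.mem_eigenspace_iff, hT, neg_one_smul]
  have hinv : ∀ y ∈ Kᗮ, T y ∈ Kᗮ := fun y hy => by
    rw [Submodule.mem_orthogonal] at hy ⊢
    intro k hk
    have h1 := hy k hk
    rw [← U.inner_map_map, (hK k).1 hk, inner_neg_left, neg_eq_zero] at h1
    exact h1
  have hne : Kᗮ ≠ ⊥ := fun h => by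
    rw [Submodule.orthogonal_eq_bot_iff] at h
    exact hx ((hK x).1 (h ▸ Submodule.mem_top))
  have : Nontrivial Kᗮ := Submodule.nontrivial_iff_ne_bot.2 hne
  obtain ⟨μ, hμ⟩ := Module.End.exists_eigenvalue (T.restrict hinv)
  obtain ⟨y, hy⟩ := hμ.exists_hasEigenvector
  have hy0 : (y : H) ≠ 0 := fun h => hy.2 (Subtype.ext h)
  have hTy : T y = μ • (y : H) := congrArg Subtype.val hy.apply_eq_smul
  refine ⟨μ, Module.End.hasEigenvalue_of_hasEigenvector
    ⟨Module.End.mem_eigenspace_iff.2 hTy, hy0⟩, ?_⟩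
  rintro rfl
  have hyK : (y : H) ∈ K := Module.End.mem_eigenspace_iff.2 hTy
  exact hy0 (inner_self_eq_zero.1 (y.2 _ hyK))

/-- An eigenvalue `μ ∉ {1, -1}` of the product of the reflections in `K` and `L` is witnessed by a
vector of `K` whose projection to `L` is shorter by the factor `‖1 + μ‖ / 2`. -/
theorem Submodule.exists_of_reflection_reflection_eq_smul (K L : Submodule ℂ H)
    [K.HasOrthogonalProjection] [L.HasOrthogonalProjection] {μ : ℂ} {x : H} (hx : x ≠ 0)
    (h : L.reflection (K.reflection x) = μ • x) (h1 : μ ≠ 1) (h2 : μ ≠ -1) :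
    ∃ a ∈ K, a ≠ 0 ∧ (∀ z ∈ K, L.starProjection z = 0 → ⟪z, a⟫_ℂ = 0) ∧
      ‖L.starProjection a‖ ^ 2 = ‖1 + μ‖ ^ 2 / 4 * ‖a‖ ^ 2 := by
  have hμ : ‖μ‖ = 1 := by
    have := congrArg norm h
    rw [LinearIsometryEquiv.norm_map, LinearIsometryEquiv.norm_map, norm_smul] at this
    exact (mul_eq_right₀ (norm_ne_zero_iff.2 hx)).1 this.symm
  have h2' : 1 + μ ≠ 0 := fun h => h2 (by linear_combination h)
  have hrefl := congrArg L.reflection h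
  rw [Submodule.reflection_reflection, map_smul, Submodule.reflection_apply,
    Submodule.reflection_apply] at hrefl
  set a := K.starProjection x
  set b := L.starProjection x
  have haK : a ∈ K := K.starProjection_apply_mem x
  have hbL : b ∈ L := L.starProjection_apply_mem x
  have hPa : K.starProjection a = a := Submodule.starProjection_eq_self_iff.2 haK
  have hPb : L.starProjection b = b := Submodule.starProjection_eq_self_iff.2 hbL
  -- `hrefl` reads `2a - x = μ(2b - x)`. Projecting it to `K` and to `L` makes `a` an eigenvector of
  -- the compression of `Π_L` to `K`, with eigenvalue `(1 + μ)² / (4μ)`.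
  have e1 : (1 + μ) • a = (2 * μ) • K.starProjection b := by
    have := congrArg K.starProjection hrefl
    simp only [map_sub, map_smul, map_nsmul, hPa] at this
    change 2 • a - a = μ • (2 • K.starProjection b - a) at this
    linear_combination (norm := module) this
  have e2 : (2 : ℂ) • L.starProjection a = (1 + μ) • b := by
    have := congrArg L.starProjection hrefl
    simp only [map_sub, map_smul, map_nsmul, hPb] at this
    change 2 • L.starProjection a - b = μ • (2 • b - b) at this
    linear_combination (norm := module) this
  have e3 : (4 * μ) • K.starProjection (L.starProjection a) = (1 + μ) ^ 2 • a := by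
    have := congrArg K.starProjection e2
    simp only [map_smul] at this
    linear_combination (norm := module) (2 * μ) • this - (1 + μ) • e1
  refine ⟨a, haK, ?_, ?_, ?_⟩
  · intro ha
    have hb : b = 0 := by
      rw [ha, map_zero, smul_zero] at e2
      exact (smul_eq_zero.1 e2.symm).resolve_left h2'
    rw [ha, hb, smul_zero, zero_sub, smul_neg, neg_inj] at hrefl
    have : (1 - μ) • x = 0 := by rw [sub_smul, one_smul, sub_eq_zero]; exact hrefl
    exact h1 (sub_eq_zero.1 ((smul_eq_zero.1 this).resolve_right hx)).symm
  · intro z hz hLz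
    -- The compression is self-adjoint, so its kernel is orthogonal to an eigenvector of nonzero
    -- eigenvalue.
    have : ⟪z, (1 + μ) ^ 2 • a⟫_ℂ = 0 := by
      rw [← e3, inner_smul_right, ← Submodule.inner_starProjection_left_eq_right,
        Submodule.starProjection_eq_self_iff.2 hz,
        ← Submodule.starProjection_eq_self_iff.2 (L.starProjection_apply_mem a),
        ← Submodule.inner_starProjection_left_eq_right, hLz, inner_zero_left, mul_zero]
    rw [inner_smul_right] at this
    exact (mul_eq_zero.1 this).resolve_left (pow_ne_zero 2 h2')
  · have h5 : ⟪a, K.starProjection (L.starProjection a)⟫_ℂ = (‖L.starProjection a‖ : ℂ) ^ 2 := by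
      have h4 := inner_self_eq_norm_sq_to_K (𝕜 := ℂ) (L.starProjection a)
      rw [Submodule.inner_starProjection_left_eq_right,
        Submodule.starProjection_eq_self_iff.2 (L.starProjection_apply_mem a)] at h4
      have h7 := K.inner_starProjection_left_eq_right a (L.starProjection a)
      rw [hPa] at h7
      exact h7.symm.trans h4
    have h6 := congrArg (fun y => ‖⟪a, y⟫_ℂ‖) e3
    simp only [inner_smul_right, h5, norm_mul, norm_pow, hμ, inner_self_eq_norm_sq_to_K] at h6
    norm_num at h6
    linarith

end Reflections

theorem Complex.sqrt_two_mul_sqrt_two : (√2 : ℂ) * (√2 : ℂ) = 2 := by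
  exact_mod_cast Real.mul_self_sqrt zero_le_two

namespace WeightedGraph

/-! ### Column spaces of `A` and `B`, and the Poincaré inequality on `G'`. -/

section Spectral

open scoped InnerProductSpace

variable {V E : Type*} [DecidableEq V] (G : WeightedGraph V E)

/-- The vector `∑_v f(v) √(wdeg v) |a_v⟩|v⟩`. -/
noncomputable def edgeLift (f : V → ℂ) : EuclideanSpace ℂ (E × V) :=
  WithLp.toLp 2 fun p => if G.head p.1 = p.2 ∨ G.tail p.1 = p.2 then (√(G.w p.1) : ℂ) * f p.2 else 0

theorem edgeLift_apply (f : V → ℂ) (e : E) (v : V) : G.edgeLift f (e, v) =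
    if G.head e = v ∨ G.tail e = v then (√(G.w e) : ℂ) * f v else 0 := rfl

theorem bVec_head (e : E) : G.bVec e (G.head e) = 1 / (√2 : ℂ) := by
  simp [bVec, G.head_ne_tail e]

theorem bVec_tail (e : E) : G.bVec e (G.tail e) = -1 / (√2 : ℂ) := by
  simp [bVec, (G.head_ne_tail e).symm, neg_div]

theorem conj_bVec (e : E) (v : V) : (starRingEnd ℂ) (G.bVec e v) = G.bVec e v :=
  Complex.conj_ofReal _

theorem sum_bVec_mul [Fintype V] (e : E) (F : V → ℂ) :
    ∑ v, G.bVec e v * F v = (F (G.head e) - F (G.tail e)) / (√2 : ℂ) := by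
  have : ∀ v, G.bVec e v * F v = ((if v = G.head e then F v else 0)
      - (if v = G.tail e then F v else 0)) / (√2 : ℂ) := fun v => by
    rw [bVec]; split_ifs <;> push_cast <;> ring
  simp [this, ← Finset.sum_div, Finset.sum_sub_distrib]

variable [Fintype E]

theorem toEuclideanLin_walkB_apply [DecidableEq E] (y : EuclideanSpace ℂ E) (e : E) (v : V) :
    Matrix.toEuclideanLin G.walkB y (e, v) = G.bVec e v * y e := by
  simp [Matrix.toLpLin_apply, Matrix.mulVec, dotProduct, walkB]

/-- This is `Bᴴ B = 1`: the columns of `B` are orthonormal. -/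
theorem toEuclideanLin_walkB_head_sub_tail [DecidableEq E] (y : EuclideanSpace ℂ E) (e : E) :
    (Matrix.toEuclideanLin G.walkB y (e, G.head e) - Matrix.toEuclideanLin G.walkB y (e, G.tail e))
      / (√2 : ℂ) = y e := by
  have h2 := Complex.sqrt_two_mul_sqrt_two
  have h0 : (√2 : ℂ) ≠ 0 := fun h => by simp [h] at h2
  rw [toEuclideanLin_walkB_apply, toEuclideanLin_walkB_apply, bVec_head, bVec_tail]
  field_simp
  linear_combination (-y e) * h2

theorem w_le_wdeg (e : E) {v : V}
    (h : G.head e = v ∨ G.tail e = v) : G.w e ≤ G.wdeg v :=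
  Finset.single_le_sum (f := G.w) (fun e _ => (G.w_pos e).le)
    (by simpa [incidentEdges] using h)

theorem wdeg_addUnitEdge_le {s t : V} (hst : s ≠ t) (v : V) :
    (G.addUnitEdge s t hst).wdeg v ≤ G.wdeg v + 1 := by
  rw [wdeg_eq_sum, wdeg_eq_sum, Fintype.sum_option, add_comm]
  refine add_le_add le_rfl ?_
  simp only [addUnitEdge, Option.elim]
  by_cases h1 : s = v
  · have h2 : t ≠ v := fun h => hst (h1.trans h.symm)
    simp [h1, h2]
  · by_cases h2 : t = v <;> simp [h1, h2]

variable [Fintype V]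

/-- A Poincaré inequality for the graph with the added edge, in terms of the expansion of the
original graph. -/
theorem expansion_sq_mul_le_addUnitEdge {s t : V} (hst : s ≠ t) {κ : ℝ} (hκ : 0 ≤ κ)
    (h : ∀ v, (G.addUnitEdge s t hst).wdeg v ≤ κ * G.wdeg v) (g : V → ℝ)
    (hg : ∑ v, (G.addUnitEdge s t hst).wdeg v * g v = 0) :
    G.expansion ^ 2 * ∑ v, (G.addUnitEdge s t hst).wdeg v * g v ^ 2 ≤
      2 * κ * ∑ e, (G.addUnitEdge s t hst).w e *
        (g ((G.addUnitEdge s t hst).head e) - g ((G.addUnitEdge s t hst).tail e)) ^ 2 := by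
  have : Nonempty V := ⟨s⟩
  obtain ⟨m, hm⟩ := G.exists_cheeger g
  set G' := G.addUnitEdge s t hst
  -- The second moment is least about the mean, which is `0` for the degrees of `G'`.
  have h1 : ∑ v, G'.wdeg v * g v ^ 2 ≤ ∑ v, G'.wdeg v * (g v - m) ^ 2 := by
    have : ∑ v, G'.wdeg v * (g v - m) ^ 2 = ∑ v, G'.wdeg v * g v ^ 2
        - 2 * m * ∑ v, G'.wdeg v * g v + ∑ v, G'.wdeg v * m ^ 2 := by
      rw [Finset.mul_sum, ← Finset.sum_sub_distrib, ← Finset.sum_add_distrib]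
      exact Finset.sum_congr rfl fun v _ => by ring
    rw [this, hg, mul_zero, sub_zero]
    exact le_add_of_nonneg_right
      (Finset.sum_nonneg fun v _ => mul_nonneg (G'.wdeg_nonneg v) (sq_nonneg m))
  have h2 : ∑ v, G'.wdeg v * (g v - m) ^ 2 ≤ κ * ∑ v, G.wdeg v * (g v - m) ^ 2 := by
    rw [Finset.mul_sum]
    refine Finset.sum_le_sum fun v _ => ?_
    rw [← mul_assoc]
    exact mul_le_mul_of_nonneg_right (h v) (sq_nonneg _)
  have h3 : ∑ e, G.w e * (g (G.head e) - g (G.tail e)) ^ 2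
      ≤ ∑ e, G'.w e * (g (G'.head e) - g (G'.tail e)) ^ 2 := by
    rw [Fintype.sum_option]
    exact le_add_of_nonneg_left (mul_nonneg (G'.w_pos none).le (sq_nonneg _))
  calc G.expansion ^ 2 * ∑ v, G'.wdeg v * g v ^ 2
      ≤ G.expansion ^ 2 * (κ * ∑ v, G.wdeg v * (g v - m) ^ 2) :=
        mul_le_mul_of_nonneg_left (h1.trans h2) (sq_nonneg _)
    _ = κ * (G.expansion ^ 2 * ∑ v, G.wdeg v * (g v - m) ^ 2) := by ring
    _ ≤ κ * (2 * ∑ e, G.w e * (g (G.head e) - g (G.tail e)) ^ 2) :=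
        mul_le_mul_of_nonneg_left hm hκ
    _ ≤ κ * (2 * ∑ e, G'.w e * (g (G'.head e) - g (G'.tail e)) ^ 2) := by gcongr
    _ = _ := by ring

theorem expansion_sq_mul_norm_le_addUnitEdge {s t : V} (hst : s ≠ t) {κ : ℝ} (hκ : 0 ≤ κ)
    (h : ∀ v, (G.addUnitEdge s t hst).wdeg v ≤ κ * G.wdeg v) (f : V → ℂ)
    (hf : ∑ v, (G.addUnitEdge s t hst).wdeg v • f v = 0) :
    G.expansion ^ 2 * ∑ v, (G.addUnitEdge s t hst).wdeg v * ‖f v‖ ^ 2 ≤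
      2 * κ * ∑ e, (G.addUnitEdge s t hst).w e *
        ‖f ((G.addUnitEdge s t hst).head e) - f ((G.addUnitEdge s t hst).tail e)‖ ^ 2 := by
  have hre := G.expansion_sq_mul_le_addUnitEdge hst hκ h (fun v => (f v).re)
    (by simpa using congrArg Complex.re hf)
  have him := G.expansion_sq_mul_le_addUnitEdge hst hκ h (fun v => (f v).im)
    (by simpa using congrArg Complex.im hf)
  have hnorm : ∀ z : ℂ, ‖z‖ ^ 2 = z.re ^ 2 + z.im ^ 2 := fun z => by
    rw [Complex.sq_norm, Complex.normSq_apply]; ring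
  simp only [hnorm, mul_add, Finset.sum_add_distrib, Complex.sub_re, Complex.sub_im]
  exact add_le_add hre him

theorem toEuclideanLin_walkA_apply (y : EuclideanSpace ℂ V) (e : E) (v : V) :
    Matrix.toEuclideanLin G.walkA y (e, v) = G.aVec v e * y v := by
  simp [Matrix.toLpLin_apply, Matrix.mulVec, dotProduct, walkA]

/-- Dividing coordinates by `√(wdeg v)` turns the normalized Laplacian into the plain Dirichlet
form. A vertex of degree zero has no incident edge, so division by zero there is harmless. -/
theorem exists_edgeLift_eq {a : EuclideanSpace ℂ (E × V)} (ha : a ∈ G.walkA.columnSpace) :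
    ∃ f, G.edgeLift f = a := by
  obtain ⟨y, rfl⟩ := ha
  refine ⟨fun v => y v / (√(G.wdeg v) : ℂ), ?_⟩
  ext ⟨e, v⟩
  rw [toEuclideanLin_walkA_apply, edgeLift_apply, aVec]
  split_ifs
  · push_cast; ring
  · simp

theorem edgeLift_mem (f : V → ℂ) : G.edgeLift f ∈ G.walkA.columnSpace := by
  refine ⟨WithLp.toLp 2 fun v => f v * (√(G.wdeg v) : ℂ), ?_⟩
  ext ⟨e, v⟩
  rw [toEuclideanLin_walkA_apply, edgeLift_apply, aVec]
  split_ifs with h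
  · have h0 : 0 < G.wdeg v := (G.w_pos e).trans_le (G.w_le_wdeg e h)
    have h1 : (√(G.wdeg v) : ℂ) ≠ 0 := by exact_mod_cast (Real.sqrt_pos.2 h0).ne'
    push_cast
    field_simp
  · simp

theorem sum_ite_incident {M : Type*} [AddCommMonoid M] (F : E → V → M) :
    ∑ p : E × V, (if G.head p.1 = p.2 ∨ G.tail p.1 = p.2 then F p.1 p.2 else 0)
      = ∑ e, (F e (G.head e) + F e (G.tail e)) := by
  rw [Fintype.sum_prod_type]
  refine Finset.sum_congr rfl fun e => fun _ => ?_
  have hne := G.head_ne_tail e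
  have : ∀ v, (if G.head e = v ∨ G.tail e = v then F e v else 0)
      = (if G.head e = v then F e v else 0) + (if G.tail e = v then F e v else 0) := fun v => by
    by_cases h1 : G.head e = v
    · have h2 : G.tail e ≠ v := fun h => hne (h1.trans h.symm)
      simp [h1, h2]
    · simp [h1]
  simp [this, Finset.sum_add_distrib]

theorem inner_edgeLift_one (f : V → ℂ) :
    ⟪G.edgeLift 1, G.edgeLift f⟫_ℂ = ∑ v, G.wdeg v • f v := by
  rw [sum_wdeg_smul, PiLp.inner_apply]
  simp only [smul_add]
  rw [← G.sum_ite_incident fun e v => G.w e • f v]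
  refine Finset.sum_congr rfl fun p _ => ?_
  obtain ⟨e, v⟩ := p
  rw [edgeLift_apply, edgeLift_apply]
  have : (√(G.w e) : ℂ) * (√(G.w e) : ℂ) = (G.w e : ℂ) := by
    exact_mod_cast Real.mul_self_sqrt (G.w_pos e).le
  split_ifs
  · simp [← this]; ring
  · simp

theorem norm_edgeLift_sq (f : V → ℂ) : ‖G.edgeLift f‖ ^ 2 = ∑ v, G.wdeg v * ‖f v‖ ^ 2 := by
  rw [sum_wdeg_mul, EuclideanSpace.norm_sq_eq]
  simp only [mul_add]
  rw [← G.sum_ite_incident fun e v => G.w e * ‖f v‖ ^ 2]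
  refine Finset.sum_congr rfl fun p _ => ?_
  obtain ⟨e, v⟩ := p
  rw [edgeLift_apply]
  split_ifs
  · rw [norm_mul, mul_pow, Complex.norm_real, Real.norm_eq_abs, sq_abs,
      Real.sq_sqrt (G.w_pos e).le]
  · simp

variable [DecidableEq E]

theorem inner_toEuclideanLin_walkB (y : EuclideanSpace ℂ E) (u : EuclideanSpace ℂ (E × V)) :
    ⟪Matrix.toEuclideanLin G.walkB y, u⟫_ℂ =
      ∑ e, (starRingEnd ℂ) (y e) * ((u (e, G.head e) - u (e, G.tail e)) / (√2 : ℂ)) := by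
  rw [PiLp.inner_apply, Fintype.sum_prod_type]
  refine Finset.sum_congr rfl fun e _ => ?_
  rw [← G.sum_bVec_mul e fun v => u (e, v), Finset.mul_sum]
  refine Finset.sum_congr rfl fun v _ => ?_
  rw [toEuclideanLin_walkB_apply, RCLike.inner_apply, map_mul, conj_bVec]
  ring

theorem norm_toEuclideanLin_walkB (y : EuclideanSpace ℂ E) :
    ‖Matrix.toEuclideanLin G.walkB y‖ = ‖y‖ := by
  have h : ⟪Matrix.toEuclideanLin G.walkB y, Matrix.toEuclideanLin G.walkB y⟫_ℂ = ⟪y, y⟫_ℂ := by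
    rw [inner_toEuclideanLin_walkB, PiLp.inner_apply]
    refine Finset.sum_congr rfl fun e _ => ?_
    rw [toEuclideanLin_walkB_head_sub_tail, RCLike.inner_apply]
    ring
  rw [inner_self_eq_norm_sq_to_K, inner_self_eq_norm_sq_to_K] at h
  have h' : ‖Matrix.toEuclideanLin G.walkB y‖ ^ 2 = ‖y‖ ^ 2 := by exact_mod_cast h
  exact (sq_eq_sq₀ (norm_nonneg _) (norm_nonneg _)).1 h'

/-- By orthonormality of the columns, the projection is `B Bᴴ`. -/
theorem starProjection_walkB (u : EuclideanSpace ℂ (E × V)) :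
    G.walkB.columnSpace.starProjection u = Matrix.toEuclideanLin G.walkB
      (WithLp.toLp 2 fun e => (u (e, G.head e) - u (e, G.tail e)) / (√2 : ℂ)) := by
  refine Submodule.eq_starProjection_of_mem_of_inner_eq_zero ⟨_, rfl⟩ ?_
  rintro _ ⟨y, rfl⟩
  rw [inner_eq_zero_symm, inner_sub_right, sub_eq_zero, inner_toEuclideanLin_walkB,
    inner_toEuclideanLin_walkB]
  refine Finset.sum_congr rfl fun e _ => ?_
  rw [toEuclideanLin_walkB_head_sub_tail]

theorem norm_starProjection_walkB_edgeLift_sq (f : V → ℂ) :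
    ‖G.walkB.columnSpace.starProjection (G.edgeLift f)‖ ^ 2 =
      (∑ e, G.w e * ‖f (G.head e) - f (G.tail e)‖ ^ 2) / 2 := by
  rw [starProjection_walkB, norm_toEuclideanLin_walkB, EuclideanSpace.norm_sq_eq, Finset.sum_div]
  refine Finset.sum_congr rfl fun e _ => ?_
  simp only [edgeLift_apply, true_or, or_true, if_true]
  rw [← mul_sub, norm_div, norm_mul, div_pow, mul_pow, Complex.norm_real, Complex.norm_real,
    Real.norm_eq_abs, Real.norm_eq_abs, sq_abs, sq_abs, Real.sq_sqrt (G.w_pos e).le,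
    Real.sq_sqrt zero_le_two]

end Spectral

end WeightedGraph

namespace WeightedGraph

/-! ### Size of the degree and weight ratio, and the bound on eigenvalues. -/

section Parameters

variable {V E : Type*} (G : WeightedGraph V E)

theorem one_le_weightRatio [Finite E] [Nonempty E] : 1 ≤ G.weightRatio := by
  obtain ⟨e, he⟩ := exists_eq_ciInf_of_finite (f := G.w)
  rw [weightRatio, ← he, one_le_div (G.w_pos e)]
  exact le_ciSup (Set.finite_range _).bddAbove e

theorem Connected.exists_incident [Nontrivial V] {G : WeightedGraph V E} (h : G.Connected)
    (v : V) : ∃ e, G.head e = v ∨ G.tail e = v := by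
  obtain ⟨u, e, he⟩ := h.preconnected.exists_adj_of_nontrivial v
  exact ⟨e, he.imp And.left And.right⟩

theorem one_le_maxDegree [Fintype V] [DecidableEq V] [Fintype E] {G : WeightedGraph V E} (e : E) :
    1 ≤ G.maxDegree :=
  (Finset.card_pos.2 ⟨e, by simp [incidentEdges]⟩).trans_le
    (Finset.le_sup (f := fun v => (G.incidentEdges v).card) (Finset.mem_univ (G.head e)))

end Parameters

section Gap

variable {V E : Type*} [Fintype V] [DecidableEq V] [Fintype E] [DecidableEq E]
  (G : WeightedGraph V E)

/-- The walk operator of a graph with an edge has an eigenvalue other than `-1`. -/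
theorem exists_hasEigenvalue_walkOperator (e : E) :
    ∃ μ : ℂ, (walkOperator G.walkA G.walkB).HasEigenvalue μ ∧ μ ≠ -1 := by
  let f : V → ℂ := Pi.single (G.head e) 1
  have hpos : 0 < ‖G.walkB.columnSpace.starProjection (G.edgeLift f)‖ ^ 2 := by
    rw [norm_starProjection_walkB_edgeLift_sq]
    refine half_pos (Finset.sum_pos' (fun e _ => mul_nonneg (G.w_pos e).le (sq_nonneg _))
      ⟨e, Finset.mem_univ e, ?_⟩)
    simpa [f, (G.head_ne_tail e).symm] using G.w_pos e
  refine LinearIsometryEquiv.exists_hasEigenvalue_ne_neg_one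
    (G.walkA.columnSpace.reflection.trans G.walkB.columnSpace.reflection) (x := G.edgeLift f) ?_
  -- The lift is fixed by the reflection in the column space of `A`, so being negated by `U` would
  -- force its projection to that of `B` to vanish, against `hpos`.
  intro h
  rw [LinearIsometryEquiv.trans_apply, Submodule.reflection_eq_self_iff _ |>.2 (G.edgeLift_mem f),
    Submodule.reflection_apply, sub_eq_neg_self,
    two_nsmul, ← two_smul ℂ] at h
  rw [(smul_eq_zero.1 h).resolve_left two_ne_zero] at hpos
  simp at hpos

/-- An eigenvalue `μ ∉ {1, -1}` of the walk operator gives an eigenvector of the normalized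
Laplacian, with eigenvalue `‖1 + μ‖ ^ 2 / 2`. -/
theorem exists_of_hasEigenvalue_walkOperator {μ : ℂ}
    (hμ : (walkOperator G.walkA G.walkB).HasEigenvalue μ) (h1 : μ ≠ 1) (h2 : μ ≠ -1) :
    ∃ f : V → ℂ, ∑ v, G.wdeg v • f v = 0 ∧ 0 < ∑ v, G.wdeg v * ‖f v‖ ^ 2 ∧
      2 * ∑ e, G.w e * ‖f (G.head e) - f (G.tail e)‖ ^ 2 =
        ‖1 + μ‖ ^ 2 * ∑ v, G.wdeg v * ‖f v‖ ^ 2 := by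
  obtain ⟨x, hx⟩ := hμ.exists_hasEigenvector
  have hUx : G.walkB.columnSpace.reflection (G.walkA.columnSpace.reflection x) = μ • x :=
    hx.apply_eq_smul
  obtain ⟨a, haK, ha0, horth, hnorm⟩ :=
    Submodule.exists_of_reflection_reflection_eq_smul _ _ hx.2 hUx h1 h2
  obtain ⟨f, rfl⟩ := G.exists_edgeLift_eq haK
  refine ⟨f, ?_, ?_, ?_⟩
  · rw [← inner_edgeLift_one]
    -- Constants have zero energy, so `edgeLift 1` is killed by `Π_B` and `a` is orthogonal to it.
    refine horth _ (G.edgeLift_mem _) ?_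
    rw [← norm_eq_zero, ← sq_eq_zero_iff, norm_starProjection_walkB_edgeLift_sq]
    simp
  · rw [← norm_edgeLift_sq]
    exact pow_pos (norm_pos_iff.2 ha0) 2
  · rw [norm_starProjection_walkB_edgeLift_sq] at hnorm
    rw [← norm_edgeLift_sq]
    linear_combination 4 * hnorm

theorem expansion_sq_le_of_hasEigenvalue [Nontrivial V] {s t : V} (hst : s ≠ t) {κ : ℝ}
    (hκ : 1 ≤ κ) (h : ∀ v, (G.addUnitEdge s t hst).wdeg v ≤ κ * G.wdeg v) {μ : ℂ}
    (hμ : (walkOperator (G.addUnitEdge s t hst).walkA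
      (G.addUnitEdge s t hst).walkB).HasEigenvalue μ) (hμ' : μ ≠ -1) :
    G.expansion ^ 2 ≤ κ * ‖μ - -1‖ ^ 2 := by
  rw [sub_neg_eq_add, add_comm]
  rcases eq_or_ne μ 1 with rfl | h1
  · have := pow_le_one₀ (n := 2) G.expansion_nonneg G.expansion_le_one
    norm_num
    linarith
  obtain ⟨f, hf, hpos, hen⟩ :=
    (G.addUnitEdge s t hst).exists_of_hasEigenvalue_walkOperator hμ h1 hμ'
  refine le_of_mul_le_mul_right ?_ hpos
  refine (G.expansion_sq_mul_norm_le_addUnitEdge hst (zero_le_one.trans hκ) h f hf).trans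
    (le_of_eq ?_)
  rw [mul_assoc, mul_assoc, ← hen]
  ring

end Gap

end WeightedGraph

theorem lemma7 :
    ∃ C : ℝ, 0 < C ∧
      ∀ (V E : Type*) [Fintype V] [DecidableEq V] [Fintype E] [DecidableEq E]
        (G : WeightedGraph V E) (s t : V) (hst : s ≠ t),
        G.Connected →
        (∀ e, 1 / ((G.maxDegree : ℝ) * G.weightRatio) ≤ G.w e ∧
          G.w e ≤ 1 / (G.maxDegree : ℝ)) →
        C * (G.expansion / √((G.maxDegree : ℝ) * G.weightRatio)) ≤
          eigenvalueGap
            (walkOperator (G.addUnitEdge s t hst).walkA (G.addUnitEdge s t hst).walkB)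
            (-1) := by
  refine ⟨1 / 2, by norm_num, ?_⟩
  intro V E _ _ _ _ G s t hst hconn hw
  have : Nontrivial V := ⟨s, t, hst⟩
  obtain ⟨e₀, -⟩ := hconn.exists_incident s
  have : Nonempty E := ⟨e₀⟩
  have hd : (1 : ℝ) ≤ G.maxDegree := by exact_mod_cast WeightedGraph.one_le_maxDegree e₀
  set r := (G.maxDegree : ℝ) * G.weightRatio
  have hr : 1 ≤ r := one_le_mul_of_one_le_of_one_le hd G.one_le_weightRatio
  have hr0 : 0 < r := zero_lt_one.trans_le hr
  have hdeg : ∀ v, (G.addUnitEdge s t hst).wdeg v ≤ (1 + r) * G.wdeg v := fun v => by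
    obtain ⟨e, he⟩ := hconn.exists_incident v
    have h1 : 1 ≤ G.wdeg v * r :=
      (div_le_iff₀ hr0).1 ((hw e).1.trans (G.w_le_wdeg e he))
    linarith [G.wdeg_addUnitEdge_le hst v]
  -- Nonemptiness is needed because `sInf ∅ = 0` would make the gap zero.
  obtain ⟨μ₀, hμ₀⟩ := (G.addUnitEdge s t hst).exists_hasEigenvalue_walkOperator none
  refine le_csInf ⟨_, μ₀, hμ₀, rfl⟩ ?_
  rintro _ ⟨μ, ⟨hμ, hμ'⟩, rfl⟩
  have key := G.expansion_sq_le_of_hasEigenvalue hst (by linarith : 1 ≤ 1 + r) hdeg hμ hμ'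
  refine (abs_le_of_sq_le_sq' ?_ (norm_nonneg _)).2
  rw [mul_pow, div_pow _ (√r), Real.sq_sqrt hr0.le, ← mul_div_assoc, div_le_iff₀ hr0]
  -- As `r ≥ 1`, `1 + r ≤ 2 * r`, so `φ² / r ≤ 2 ‖μ + 1‖²`; the constant `1 / 2` leaves room.
  nlinarith [mul_le_mul_of_nonneg_right hr (sq_nonneg ‖μ - -1‖)]
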